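/- For a function $f:\mathbb{F}_2^n\to\{0,1\}$ say that $f$ is odd-cycle-free on a set $G\subseteq\mathbb{F}_2^n$ if there are no odd $m\ge 1$ and (not necessarily distinct) $x_1,\dots,x_m\in G$ with $x_1+\cdots+x_m=0$ and $f(x_1)=\cdots=f(x_m)=1$; $f$ is odd-cycle-free if it is so on $G=\mathbb{F}_2^n$. The function $f$ is $\epsilon$-far from odd-cycle-free if $\Pr_x[f(x)\neq g(x)]\ge\epsilon$ (for $x$ uniform in $\mathbb{F}_2^n$) for every odd-cycle-free $g:\mathbb{F}_2^n\to\{0,1\}$. The edge-sampling test with parameter $k$, given oracle access to $f$, picks $\alpha_1,\dots,\alpha_k\in\mathbb{F}_2^n$ independently and uniformly at random, queries $f$ on all points of $G=\{\alpha_i-\alpha_j : i<j\}$, and accepts if and only if $f$ is odd-cycle-free on $G$. Theorem. There are functions $k,q:(0,1)\to\mathbb{N}$ with $k(\epsilon)=\tilde O(1/\epsilon)$ and $q(\epsilon)=\tilde O(1/\epsilon^2)$, where $\tilde O$ hides a constant factor and a power of $1+\log(1/\epsilon)$, such that for every $\epsilon\in(0,1)$ and every $n\geq 0$ the edge-sampling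 test with parameter $k(\epsilon)$ is a one-sided tester for odd-cycle-freeness with query complexity at most $q(\epsilon)$. That is, for every $f:\mathbb{F}_2^n\to\{0,1\}$: the test always makes at most $q(\epsilon)$ queries; if $f$ is odd-cycle-free, it accepts with probability $1$; and if $f$ is $\epsilon$-far from odd-cycle-free, it rejects with probability at least $2/3$. -/

import Mathlib

namespace PropertyTesting

/-- The vector space `𝔽₂ⁿ`. -/
abbrev Cube (n : ℕ) : Type := Fin n → ZMod 2

/-- Boolean functions `𝔽₂ⁿ → {0,1}`. -/
abbrev BoolFun (n : ℕ) : Type := Cube n → Bool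

/-! ### Odd-cycle-freeness -/

/-- The restriction of `f` to `G` is odd-cycle-free: for no odd `m` are there (not necessarily
distinct) points `x₁, …, xₘ` of `G` with `x₁ + ⋯ + xₘ = 0` and `f (xᵢ) = 1` for all `i`. -/
def OddCycleFreeOn {n : ℕ} (G : Set (Cube n)) (f : BoolFun n) : Prop :=
  ∀ m : ℕ, Odd m →
    ¬ ∃ x : Fin m → Cube n, (∀ i, x i ∈ G) ∧ ∑ i, x i = 0 ∧ ∀ i, f (x i) = true

/-- `f` is odd-cycle-free. -/
def OddCycleFree {n : ℕ} (f : BoolFun n) : Prop :=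
  ∀ m : ℕ, Odd m → ¬ ∃ x : Fin m → Cube n, ∑ i, x i = 0 ∧ ∀ i, f (x i) = true

/-! ### Distance -/

/-- The relative Hamming distance `δ(f, g) = Pr_x [f x ≠ g x]`, `x` uniform in `𝔽₂ⁿ`. -/
noncomputable def relDist {n : ℕ} (f g : BoolFun n) : ℝ :=
  (hammingDist f g : ℝ) / (2 : ℝ) ^ n

/-- `f` is `ε`-far from the property `P`: the minimum of `δ(f, g)` over `g ∈ P` is at least `ε`. -/
def IsFar {n : ℕ} (P : Set (BoolFun n)) (ε : ℝ) (f : BoolFun n) : Prop :=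
  ∀ g ∈ P, ε ≤ relDist f g

/-! ### Query algorithms -/

/-- A deterministic (adaptive) algorithm with oracle access to a function `Q → Bool`, as a decision
tree: it either returns a result, or asks for the value at a point and continues according to
the answer. -/
inductive QueryAlg (Q A : Type) : Type where
  | ret : A → QueryAlg Q A
  | ask : Q → (Bool → QueryAlg Q A) → QueryAlg Q A

namespace QueryAlg

variable {Q A B : Type}

/-- The result of the algorithm on the oracle `f`. -/
def run : QueryAlg Q A → (Q → Bool) → A
  | ret a, _ => a
  | ask q next, f => run (next (f q)) f

/-- The number of oracle queries that the algorithm makes on the oracle `f`. -/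
def queries : QueryAlg Q A → (Q → Bool) → ℕ
  | ret _, _ => 0
  | ask q next, f => queries (next (f q)) f + 1

/-- Post-processing of the result, without further queries. -/
def map (φ : A → B) : QueryAlg Q A → QueryAlg Q B
  | ret a => ret (φ a)
  | ask q next => ask q fun b => map φ (next b)

/-- Query all points of the list `l` and return the table `t`, overwritten at the points of `l` by
the answers. -/
def queryAll [DecidableEq Q] : List Q → (Q → Bool) → QueryAlg Q (Q → Bool)
  | [], t => ret t
  | q :: l, t => ask q fun b => queryAll l (Function.update t q b)

end QueryAlg

/-- A randomized oracle algorithm for Boolean functions on `𝔽₂ⁿ` with a verdict (`true` = accept):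
a probability distribution over deterministic ones. -/
abbrev RandAlg (n : ℕ) : Type := PMF (QueryAlg (Cube n) Bool)

/-- The probability that the randomized algorithm `T` gives the verdict `b` on the input `f`. -/
noncomputable def probVerdict {n : ℕ} (T : RandAlg n) (f : BoolFun n) (b : Bool) : ENNReal :=
  (T.map fun D => D.run f) b

/-- `T` makes at most `q` queries, on every input and for every outcome of its coin tosses. -/
def QueryComplexityLE {n : ℕ} (T : RandAlg n) (q : ℕ) : Prop :=
  ∀ D ∈ T.support, ∀ f : BoolFun n, D.queries f ≤ q

/-- The family `T ε n` (`ε` the proximity parameter, `n` the dimension) is a one-sided error tester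
for the property `P`: it accepts every `f ∈ P` with probability `1` and rejects every `f` that is
`ε`-far from `P` with probability at least `2/3`. -/
def IsOneSidedTester (P : ∀ n : ℕ, Set (BoolFun n)) (T : ℝ → ∀ n : ℕ, RandAlg n) : Prop :=
  ∀ ε : ℝ, 0 < ε → ε < 1 → ∀ (n : ℕ) (f : BoolFun n),
    (f ∈ P n → probVerdict (T ε n) f true = 1) ∧
    (IsFar (P n) ε f → 2 / 3 ≤ probVerdict (T ε n) f false)

/-! ### The edge-sampling test -/

/-- The set of differences `αᵢ - αⱼ`, `i < j`. -/
def differences {n k : ℕ} (α : Fin k → Cube n) : Finset (Cube n) :=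
  ((Finset.univ : Finset (Fin k × Fin k)).filter fun p => p.1 < p.2).image
    fun p => α p.1 - α p.2

open Classical in
/-- The edge-sampling test for fixed sample points `α`: query all points of
`G = {αᵢ - αⱼ : i < j}`, and accept if and only if the recorded table is odd-cycle-free on `G`. -/
noncomputable def edgeSamplingFor {n k : ℕ} (α : Fin k → Cube n) : QueryAlg (Cube n) Bool :=
  (QueryAlg.queryAll (differences α).toList fun _ => false).map
    fun t => decide (OddCycleFreeOn (differences α : Set (Cube n)) t)

/-- The edge-sampling test with `k` independent uniform sample points of `𝔽₂ⁿ`. -/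
noncomputable def edgeSamplingTest (k n : ℕ) : RandAlg n :=
  (PMF.uniformOfFintype (Fin k → Cube n)).map edgeSamplingFor

/-! ### Soft-O -/

/-- `r(ε) = Õ(s(ε))` on `0 < ε < 1`: up to a constant and a power of the logarithm of `1/ε`, `r` is
bounded by `s`. -/
def IsSoftO (r : ℝ → ℕ) (s : ℝ → ℝ) : Prop :=
  ∃ (C : ℝ) (c : ℕ), ∀ ε : ℝ, 0 < ε → ε < 1 →
    (r ε : ℝ) ≤ C * s ε * (1 + Real.log (1 / ε)) ^ c

end PropertyTesting

namespace PropertyTesting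

open Finset

/-! ### Sequences that span no edge in a relation of bounded degree -/

section Sampling

variable {V : Type*} [Fintype V]

/-! Join `x` and `y` when `f (x - y) = 1`: a regular Cayley graph of degree `d` on `N = 2 ^ n`
vertices. Two facts reduce the theorem to testing bipartiteness of this graph with `Õ(1/ε)` random
vertices.

Distance: for each `l`, cutting `f` down to `l ⬝ᵥ x = 1` gives an odd-cycle-free function, so a far
`f` has at least `ε * N` ones on `l ⬝ᵥ x = 0`. This bounds every eigenvalue of the graph from below,
and so every 2-colouring has at least `ε * N ^ 2` monochromatic ordered pairs
(`le_card_monochromatic_of_isFar`). Acceptance: odd-cycle-freeness on the differences yields a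
linear functional that properly 2-colours the sample (`twoColourable_of_oddCycleFreeOn`).

For the bipartiteness test (`card_twoColourable_le`), put `μ = d / N`. A first sample of about `log
(1/ε) / μ` points dominates nearly all vertices, so each of its colourings forces colours on them
and leaves many conflict edges, which the second sample must avoid. Conflict edges have degree at
most `d`, and `card_avoiding_le` exploits this: avoidance has probability about `exp (-ε * j / (4 *
μ))`, up to a factor `exp (1 / μ)`. With `j` of order `log (1/ε) / ε` this beats the union bound
over the `2 ^ t` colourings. Regularity lets the first sample shrink as `μ` grows, which is why
`Õ(1/ε)` vertices suffice for every density. -/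

open Classical in
/-- The sequences of length `j` that avoid `S` and span no edge of the relation `H`. -/
noncomputable def avoiding (H : V → V → Prop) (S : Finset V) (j : ℕ) : Finset (Fin j → V) :=
  univ.filter fun x => (∀ i, x i ∉ S) ∧ ∀ i i', i < i' → ¬ H (x i) (x i')

-- Condition on the first point `b`: all later points must also avoid the neighbours of `b`, so the
-- forbidden set grows.
open Classical in
theorem card_avoiding_succ_le (H : V → V → Prop) (S : Finset V) (j : ℕ) :
    (avoiding H S (j + 1)).card ≤ ∑ b ∈ Sᶜ, (avoiding H (S ∪ univ.filter (H b)) j).card := by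
  have hmap : ∀ x ∈ avoiding H S (j + 1), x 0 ∈ Sᶜ := by
    intro x hx
    simp only [avoiding, mem_filter, mem_univ, true_and] at hx
    simpa using hx.1 0
  rw [card_eq_sum_card_fiberwise hmap]
  refine sum_le_sum fun b _ => card_le_card_of_injOn Fin.tail ?_ ?_
  · intro x hx
    simp only [avoiding, coe_filter, mem_filter, mem_univ, true_and, Set.mem_ofPred_eq] at hx ⊢
    obtain ⟨⟨h1, h2⟩, rfl⟩ := hx
    refine ⟨fun i => ?_, fun i i' hii => h2 _ _ (Fin.succ_lt_succ_iff.2 hii)⟩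
    simp only [mem_union, mem_filter, mem_univ, true_and, not_or]
    exact ⟨h1 _, h2 _ _ (Fin.succ_pos i)⟩
  · intro x hx y hy hxy
    simp only [coe_filter, Set.mem_ofPred_eq] at hx hy
    rw [← Fin.cons_self_tail x, ← Fin.cons_self_tail y, hxy, hx.2, hy.2]

open Classical in
/-- Deleting the vertices of `S` destroys at most `2 * d * #S` edges. -/
theorem card_pairs_le (H : V → V → Prop) (d : ℕ) (hout : ∀ x, (univ.filter (H x)).card ≤ d)
    (hin : ∀ y, (univ.filter fun x => H x y).card ≤ d) (S : Finset V) :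
    (univ.filter fun p : V × V => H p.1 p.2).card ≤
      (univ.filter fun p : V × V => p.1 ∉ S ∧ p.2 ∉ S ∧ H p.1 p.2).card + 2 * d * S.card := by
  have hsub : (univ.filter fun p : V × V => H p.1 p.2) ⊆
      (univ.filter fun p : V × V => p.1 ∉ S ∧ p.2 ∉ S ∧ H p.1 p.2) ∪
      ((univ.filter fun p : V × V => p.1 ∈ S ∧ H p.1 p.2) ∪
        (univ.filter fun p : V × V => p.2 ∈ S ∧ H p.1 p.2)) := by
    intro p hp
    simp only [mem_filter, mem_univ, true_and, mem_union] at hp ⊢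
    tauto
  have h1 : (univ.filter fun p : V × V => p.1 ∈ S ∧ H p.1 p.2).card ≤ d * S.card := by
    rw [mul_comm]
    refine card_le_mul_card_image_of_maps_to (f := Prod.fst) ?_ d ?_ |>.trans_eq (mul_comm _ _)
    · intro p hp
      simp only [mem_filter, mem_univ, true_and] at hp
      exact hp.1
    · intro b _
      refine (card_le_card_of_injOn Prod.snd ?_ ?_).trans (hout b)
      · intro p hp
        simp only [coe_filter, mem_filter, mem_univ, true_and, Set.mem_ofPred_eq] at hp ⊢
        rw [← hp.2]; exact hp.1.2
      · intro p hp q hq hpq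
        simp only [coe_filter, Set.mem_ofPred_eq] at hp hq
        exact Prod.ext (hp.2.trans hq.2.symm) hpq
  have h2 : (univ.filter fun p : V × V => p.2 ∈ S ∧ H p.1 p.2).card ≤ d * S.card := by
    rw [mul_comm]
    refine card_le_mul_card_image_of_maps_to (f := Prod.snd) ?_ d ?_ |>.trans_eq (mul_comm _ _)
    · intro p hp
      simp only [mem_filter, mem_univ, true_and] at hp
      exact hp.1
    · intro b _
      refine (card_le_card_of_injOn Prod.fst ?_ ?_).trans (hin b)
      · intro p hp
        simp only [coe_filter, mem_filter, mem_univ, true_and, Set.mem_ofPred_eq] at hp ⊢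
        rw [← hp.2]; exact hp.1.2
      · intro p hp q hq hpq
        simp only [coe_filter, Set.mem_ofPred_eq] at hp hq
        exact Prod.ext hpq (hp.2.trans hq.2.symm)
  have h3 := (card_le_card hsub).trans (card_union_le _ _)
  have h4 := card_union_le (univ.filter fun p : V × V => p.1 ∈ S ∧ H p.1 p.2)
    (univ.filter fun p : V × V => p.2 ∈ S ∧ H p.1 p.2)
  linarith

open Classical in
theorem card_pairs_compl_eq_sum (H : V → V → Prop) (S : Finset V) :
    (univ.filter fun p : V × V => p.1 ∉ S ∧ p.2 ∉ S ∧ H p.1 p.2).card =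
      ∑ x ∈ Sᶜ, (univ.filter (H x) \ S).card := by
  have hmap : ∀ p ∈ (univ.filter fun p : V × V => p.1 ∉ S ∧ p.2 ∉ S ∧ H p.1 p.2),
      p.1 ∈ Sᶜ := by
    intro p hp
    simp only [mem_filter, mem_univ, true_and] at hp
    simpa using hp.1
  rw [card_eq_sum_card_fiberwise hmap]
  refine sum_congr rfl fun b hb => card_bij (fun p _ => p.2) ?_ ?_ ?_
  · rintro ⟨x, y⟩ hp
    simp only [mem_filter, mem_univ, true_and, mem_sdiff] at hp ⊢
    obtain ⟨hp, rfl⟩ := hp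
    exact ⟨hp.2.2, hp.2.1⟩
  · rintro ⟨x, y⟩ hp ⟨x', y'⟩ hp' h
    simp only [mem_filter] at hp hp'
    exact Prod.ext (hp.2.trans hp'.2.symm) h
  · intro y hy
    simp only [mem_filter, mem_univ, true_and, mem_sdiff, mem_compl] at hy hb
    exact ⟨(b, y), by simp [hb, hy.1, hy.2], rfl⟩

/-- From `exp (-y) ≤ 1 / (1 + y)`; on `[0, 1]` one has `(1 - y / 2) * (1 + y) ≥ 1`. -/
theorem exp_neg_le_one_sub_half {y : ℝ} (h0 : 0 ≤ y) (h1 : y ≤ 1) :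
    Real.exp (-y) ≤ 1 - y / 2 := by
  rw [Real.exp_neg, inv_le_comm₀ (Real.exp_pos _) (by linarith)]
  refine le_trans ?_ (Real.add_one_le_exp y)
  rw [inv_le_iff_one_le_mul₀ (by linarith)]
  nlinarith

open Classical in
/-- The number of edge-avoiding sequences decays exponentially in their length. -/
theorem card_avoiding_le (H : V → V → Prop) (d : ℕ) (hd : 0 < d)
    (hout : ∀ x, (univ.filter (H x)).card ≤ d)
    (hin : ∀ y, (univ.filter fun x => H x y).card ≤ d) (e : ℝ)
    (he : e ≤ (univ.filter fun p : V × V => H p.1 p.2).card)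
    (hr : 0 ≤ (Fintype.card V : ℝ) - e / (2 * d)) (j : ℕ) (S : Finset V) :
    ((avoiding H S j).card : ℝ) ≤ ((Fintype.card V : ℝ) - e / (2 * d)) ^ j *
      Real.exp (((Fintype.card V : ℝ) - S.card) / d) := by
  have hd' : (0 : ℝ) < d := by exact_mod_cast hd
  induction j generalizing S with
  | zero =>
    have h1 : (avoiding H S 0).card ≤ 1 := by
      refine (card_le_univ _).trans ?_
      simp
    have h2 : (S.card : ℝ) ≤ Fintype.card V := by exact_mod_cast card_le_univ S
    calc ((avoiding H S 0).card : ℝ) ≤ 1 := by exact_mod_cast h1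
      _ ≤ Real.exp (((Fintype.card V : ℝ) - S.card) / d) :=
        Real.one_le_exp (div_nonneg (by linarith) hd'.le)
      _ = _ := by simp
  | succ j ih =>
    set r := (Fintype.card V : ℝ) - e / (2 * d) with hrdef
    set E := Real.exp (((Fintype.card V : ℝ) - S.card) / d)
    -- The exponential is a potential: every newly forbidden vertex lowers it by a factor `exp (-1 /
    -- d)`.
    have step : ∀ b ∈ Sᶜ, ((avoiding H (S ∪ univ.filter (H b)) j).card : ℝ) ≤
        r ^ j * E * (1 - (univ.filter (H b) \ S).card / d / 2) := by
      intro b _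
      have hc : ((S ∪ univ.filter (H b)).card : ℝ) =
          S.card + (univ.filter (H b) \ S).card := by
        rw [← union_sdiff_self_eq_union, card_union_of_disjoint disjoint_sdiff]
        push_cast; rfl
      refine (ih _).trans ?_
      rw [mul_assoc]
      refine mul_le_mul_of_nonneg_left ?_ (pow_nonneg hr j)
      have hy : ((univ.filter (H b) \ S).card : ℝ) / d ≤ 1 := by
        rw [div_le_one hd']
        exact_mod_cast (card_le_card sdiff_subset).trans (hout b)
      refine le_trans (le_of_eq ?_) (mul_le_mul_of_nonneg_left
        (exp_neg_le_one_sub_half (by positivity) hy) (Real.exp_pos _).le)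
      rw [← Real.exp_add, hc]
      congr 1
      ring
    -- The loss of at most `2 * d * #S` edges, divided by `2 * d`, cancels the `-#S` from the choice
    -- of `b` outside `S`; so `r` does not depend on `S`.
    have hsum : ∑ b ∈ Sᶜ, (1 - ((univ.filter (H b) \ S).card : ℝ) / d / 2) ≤ r := by
      rw [sum_sub_distrib, ← sum_div, ← sum_div]
      have h1 : ((Sᶜ.card : ℕ) : ℝ) = Fintype.card V - S.card := by
        rw [card_compl, Nat.cast_sub (card_le_univ S)]
      have h2 : ((univ.filter fun p : V × V => H p.1 p.2).card : ℝ) ≤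
          ∑ b ∈ Sᶜ, ((univ.filter (H b) \ S).card : ℝ) + 2 * d * S.card := by
        have := card_pairs_le H d hout hin S
        rw [card_pairs_compl_eq_sum] at this
        exact_mod_cast this
      have h3 : (e - 2 * d * S.card) / d / 2 ≤
          (∑ b ∈ Sᶜ, ((univ.filter (H b) \ S).card : ℝ)) / d / 2 := by
        gcongr
        linarith
      have h4 : (e - 2 * d * S.card) / d / 2 = e / (2 * d) - S.card := by
        field_simp
      simp only [sum_const, nsmul_eq_mul, mul_one, h1]
      linarith
    calc ((avoiding H S (j + 1)).card : ℝ)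
        ≤ ∑ b ∈ Sᶜ, ((avoiding H (S ∪ univ.filter (H b)) j).card : ℝ) := by
          exact_mod_cast card_avoiding_succ_le H S j
      _ ≤ ∑ b ∈ Sᶜ, r ^ j * E * (1 - (univ.filter (H b) \ S).card / d / 2) := sum_le_sum step
      _ = r ^ j * E * ∑ b ∈ Sᶜ, (1 - ((univ.filter (H b) \ S).card : ℝ) / d / 2) := by
          rw [mul_sum]
      _ ≤ r ^ j * E * r :=
          mul_le_mul_of_nonneg_left hsum (mul_nonneg (pow_nonneg hr j) (Real.exp_pos _).le)
      _ = r ^ (j + 1) * E := by ring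

/-! ### Testing bipartiteness of regular graphs with two samples -/

/-- The indices of `x` have a proper `2`-colouring with respect to the relation `A`. -/
def TwoColourable (A : V → V → Prop) {k : ℕ} (x : Fin k → V) : Prop :=
  ∃ c : Fin k → Bool, ∀ i j, i < j → A (x i) (x j) → c i ≠ c j

open Classical in
/-- The colouring of the neighbours of the points `u i` that the colouring `c` forces. -/
noncomputable def forced (A : V → V → Prop) {t : ℕ} (u : Fin t → V) (c : Fin t → Bool) (v : V) :
    Bool :=
  if h : ∃ i, A (u i) v then !(c h.choose) else true

open Classical in
/-- The points that are adjacent to no `u i`. -/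
noncomputable def undominated (A : V → V → Prop) {t : ℕ} (u : Fin t → V) : Finset V :=
  univ.filter fun v => ∀ i, ¬ A (u i) v

/-- The edges between dominated points to which the colouring `c` forces equal colours. -/
def Conflict (A : V → V → Prop) {t : ℕ} (u : Fin t → V) (c : Fin t → Bool) (x y : V) : Prop :=
  x ∉ undominated A u ∧ y ∉ undominated A u ∧ A x y ∧ forced A u c x = forced A u c y

/-- A proper colouring differs from the colour of every neighbour, so the neighbour picked by
`forced` already determines the value. -/
theorem eq_forced (A : V → V → Prop) {t j : ℕ} (u : Fin t → V) (w : Fin j → V)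
    (c : Fin (t + j) → Bool)
    (hc : ∀ i i', i < i' → A (Fin.append u w i) (Fin.append u w i') → c i ≠ c i') (i : Fin j)
    (hi : w i ∉ undominated A u) :
    c (Fin.natAdd t i) = forced A u (fun i => c (Fin.castAdd j i)) (w i) := by
  have h : ∃ l, A (u l) (w i) := by
    simpa [undominated] using hi
  have h1 := hc (Fin.castAdd j h.choose) (Fin.natAdd t i)
    (by rw [Fin.lt_def]; simp only [Fin.val_castAdd, Fin.val_natAdd]; omega)
    (by simpa using h.choose_spec)
  rw [forced, dif_pos h]
  revert h1
  cases c (Fin.castAdd j h.choose) <;> cases c (Fin.natAdd t i) <;> simp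

-- Union bound over the restriction of the colouring to `u`: a conflict edge inside `w` would
-- receive equal colours at both ends.
open Classical in
theorem card_twoColourable_append_le (A : V → V → Prop) {t : ℕ} (j : ℕ) (u : Fin t → V) :
    (univ.filter fun w : Fin j → V => TwoColourable A (Fin.append u w)).card ≤
      ∑ c : Fin t → Bool, (avoiding (Conflict A u c) ∅ j).card := by
  refine (card_le_card ?_).trans card_biUnion_le
  intro w hw
  simp only [mem_filter, mem_univ, true_and, mem_biUnion] at hw ⊢
  obtain ⟨c, hc⟩ := hw
  refine ⟨fun i => c (Fin.castAdd j i), ?_⟩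
  simp only [avoiding, mem_filter, mem_univ, true_and, notMem_empty, not_false_eq_true,
    implies_true]
  rintro i i' hii ⟨h1, h2, h3, h4⟩
  rw [← eq_forced A u w c hc i h1, ← eq_forced A u w c hc i' h2] at h4
  refine hc (Fin.natAdd t i) (Fin.natAdd t i') ?_ (by simpa using h3) h4
  rw [Fin.lt_def] at hii ⊢
  simp only [Fin.val_natAdd]; omega

-- Double counting: each vertex is missed by a sample exactly when all `t` points lie outside its
-- `d` neighbours.
open Classical in
theorem sum_card_undominated (A : V → V → Prop) (d : ℕ)
    (hin : ∀ y, (univ.filter fun x => A x y).card = d) (t : ℕ) :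
    ∑ u : Fin t → V, (undominated A u).card = Fintype.card V * (Fintype.card V - d) ^ t := by
  simp only [undominated, card_filter]
  rw [sum_comm]
  have : ∀ v : V, ∑ u : Fin t → V, (if ∀ i, ¬ A (u i) v then 1 else 0) =
      (Fintype.card V - d) ^ t := by
    intro v
    rw [← card_filter]
    have h : (univ.filter fun u : Fin t → V => ∀ i, ¬ A (u i) v) =
        Fintype.piFinset fun _ => (univ.filter fun x => A x v)ᶜ := by
      ext u; simp
    rw [h, Fintype.card_piFinset]
    simp only [card_compl, hin, prod_const, card_univ, Fintype.card_fin]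
  simp [this]

open Classical in
/-- A bound on the number of `2`-colourable sequences, by means of a first sample of size `t` and a second one of
size `j`. -/
theorem card_twoColourable_le (A : V → V → Prop) (hA : ∀ x y, A x y → A y x) (d : ℕ) (hd : 0 < d)
    (hdeg : ∀ x, (univ.filter (A x)).card = d) (e : ℝ) (he0 : 0 < e)
    (he : ∀ χ : V → Bool,
      e ≤ (univ.filter fun p : V × V => A p.1 p.2 ∧ χ p.1 = χ p.2).card) (t j : ℕ) :
    ((univ.filter fun x : Fin (t + j) → V => TwoColourable A x).card : ℝ) ≤
      4 * d / e * (Fintype.card V * ((Fintype.card V : ℝ) - d) ^ t) * (Fintype.card V : ℝ) ^ j +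
      (Fintype.card V : ℝ) ^ t * (2 ^ t * (((Fintype.card V : ℝ) - e / (4 * d)) ^ j *
        Real.exp ((Fintype.card V : ℝ) / d))) := by
  set N := Fintype.card V with hN
  have hd' : (0 : ℝ) < d := by exact_mod_cast hd
  have hin : ∀ y, (univ.filter fun x => A x y).card = d := by
    intro y
    rw [← hdeg y]
    congr 1
    ext x
    simp only [mem_filter, mem_univ, true_and]
    exact ⟨hA _ _, hA _ _⟩
  have heN : e ≤ d * N := by
    refine (he fun _ => true).trans ?_
    have := card_pairs_le A d (fun x => (hdeg x).le) (fun x => (hin x).le) ∅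
    have h2 := card_pairs_compl_eq_sum A (∅ : Finset V)
    simp only [compl_empty, sdiff_empty, hdeg, sum_const, card_univ, smul_eq_mul] at h2
    rw [h2] at this
    simp only [card_empty, mul_zero, add_zero] at this
    simp only [and_true]
    rw [mul_comm]
    exact_mod_cast this
  have hNd : d ≤ N := by
    rcases isEmpty_or_nonempty V with h | h
    · have : N = 0 := by simp [hN]
      rw [this] at heN; simp at heN; linarith
    · obtain ⟨x⟩ := h
      rw [← hdeg x]; exact card_le_univ _
  have hr : 0 ≤ (N : ℝ) - e / (4 * d) := by
    rw [sub_nonneg, div_le_iff₀ (by positivity)]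
    nlinarith
  have hsplit : (univ.filter fun x : Fin (t + j) → V => TwoColourable A x).card =
      ∑ u : Fin t → V,
        (univ.filter fun w : Fin j → V => TwoColourable A (Fin.append u w)).card := by
    simp only [card_filter]
    rw [← Fintype.sum_prod_type' (f := fun (u : Fin t → V) (w : Fin j → V) =>
      if TwoColourable A (Fin.append u w) then 1 else 0)]
    exact (Fintype.sum_equiv (Fin.appendEquiv t j) _ _ fun p => rfl).symm
  set M : ℝ := 2 ^ t * (((N : ℝ) - e / (4 * d)) ^ j * Real.exp ((N : ℝ) / d)) with hM
  have hM0 : 0 ≤ M := by positivity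
  have key : ∀ u : Fin t → V,
      ((univ.filter fun w : Fin j → V => TwoColourable A (Fin.append u w)).card : ℝ) ≤
        4 * d / e * (undominated A u).card * (N : ℝ) ^ j + M := by
    intro u
    -- Markov's inequality in pointwise form: for a badly dominating `u` the first summand alone
    -- exceeds the trivial bound `N ^ j`.
    by_cases hu : e ≤ 4 * d * (undominated A u).card
    · have h1 : ((univ.filter fun w : Fin j → V =>
          TwoColourable A (Fin.append u w)).card : ℝ) ≤ (N : ℝ) ^ j := by
        have := card_le_univ (univ.filter fun w : Fin j → V =>
          TwoColourable A (Fin.append u w))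
        simp only [Fintype.card_pi, prod_const, card_univ, Fintype.card_fin] at this
        exact_mod_cast this
      have h2 : 1 ≤ 4 * d / e * (undominated A u).card := by
        rw [div_mul_eq_mul_div, one_le_div he0]; exact hu
      nlinarith [pow_nonneg (Nat.cast_nonneg (α := ℝ) N) j]
    · push Not at hu
      have h1 : ∀ c : Fin t → Bool, ((avoiding (Conflict A u c) ∅ j).card : ℝ) ≤
          ((N : ℝ) - e / (4 * d)) ^ j * Real.exp ((N : ℝ) / d) := by
        intro c
        have hle : e / 2 / (2 * d) = e / (4 * d) := by field_simp; norm_num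
        have := card_avoiding_le (Conflict A u c) d hd
          (fun x => (card_le_card (fun y hy => by
            simp only [mem_filter, mem_univ, true_and] at hy ⊢; exact hy.2.2.1)).trans
              (hdeg x).le)
          (fun y => (card_le_card (fun x hx => by
            simp only [mem_filter, mem_univ, true_and] at hx ⊢; exact hx.2.2.1)).trans
              (hin y).le)
          (e / 2) ?_ (by rw [hle]; exact hr) j ∅
        · rw [hle] at this
          simpa using this
        -- Of the at least `e` monochromatic pairs, fewer than `e / 2` meet an undominated vertex;
        -- the others are conflicts.
        · have h3 := card_pairs_le (fun x y => A x y ∧ forced A u c x = forced A u c y) d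
            (fun x => (card_le_card (fun y hy => by
              simp only [mem_filter, mem_univ, true_and] at hy ⊢; exact hy.1)).trans
                (hdeg x).le)
            (fun y => (card_le_card (fun x hx => by
              simp only [mem_filter, mem_univ, true_and] at hx ⊢; exact hx.1)).trans
                (hin y).le) (undominated A u)
          have h4 : ((univ.filter fun p : V × V =>
              A p.1 p.2 ∧ forced A u c p.1 = forced A u c p.2).card : ℝ) ≤
              (univ.filter fun p : V × V => Conflict A u c p.1 p.2).card +
                2 * d * (undominated A u).card := by
            have h3' : (univ.filter fun p : V × V =>
                A p.1 p.2 ∧ forced A u c p.1 = forced A u c p.2).card ≤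
                (univ.filter fun p : V × V => Conflict A u c p.1 p.2).card +
                  2 * d * (undominated A u).card := by
              convert h3
              exact Iff.rfl
            exact_mod_cast h3'
          have h5 := he (forced A u c)
          linarith
      have h2 : ((univ.filter fun w : Fin j → V =>
          TwoColourable A (Fin.append u w)).card : ℝ) ≤ M := by
        calc _ ≤ ∑ c : Fin t → Bool, ((avoiding (Conflict A u c) ∅ j).card : ℝ) := by
              exact_mod_cast card_twoColourable_append_le A j u
          _ ≤ ∑ _c : Fin t → Bool, ((N : ℝ) - e / (4 * d)) ^ j * Real.exp ((N : ℝ) / d) :=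
              sum_le_sum fun c _ => h1 c
          _ = M := by simp [hM]
      have : 0 ≤ 4 * d / e * (undominated A u).card * (N : ℝ) ^ j := by positivity
      linarith
  rw [hsplit]
  push_cast
  refine (sum_le_sum fun u _ => key u).trans (le_of_eq ?_)
  rw [sum_add_distrib, ← sum_mul, ← mul_sum]
  have h6 : ∑ u : Fin t → V, ((undominated A u).card : ℝ) = N * ((N : ℝ) - d) ^ t := by
    rw [← Nat.cast_sum, sum_card_undominated A d hin t]
    rw [← hN, Nat.cast_mul, Nat.cast_pow, Nat.cast_sub hNd]
  rw [h6]
  simp [hN]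

end Sampling

/-! ### Choice of the sample sizes -/

/-- The parameter `log (1 / ε) + O(1)` that governs the sample sizes. -/
noncomputable def logFactor (ε : ℝ) : ℝ := Real.log (24 / ε) + 7

/-- The number of points that the edge-sampling test picks. -/
noncomputable def sampleSize (ε : ℝ) : ℕ := ⌈logFactor ε / ε⌉₊ + ⌈4 * logFactor ε / ε⌉₊

open Classical in
/-- In a regular graph that is `ε`-far from bipartite, few sequences of vertices of length
`Õ(1/ε)` are `2`-colourable. -/
theorem three_mul_card_twoColourable_le {V : Type*} [Fintype V] [Nonempty V] (A : V → V → Prop)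
    (hA : ∀ x y, A x y → A y x) (d : ℕ) (hdeg : ∀ x, (univ.filter (A x)).card = d) (ε : ℝ)
    (hε0 : 0 < ε) (hε1 : ε < 1)
    (hε : ∀ χ : V → Bool, ε * (Fintype.card V : ℝ) ^ 2 ≤
      (univ.filter fun p : V × V => A p.1 p.2 ∧ χ p.1 = χ p.2).card) :
    3 * ((univ.filter fun x : Fin (sampleSize ε) → V => TwoColourable A x).card : ℝ) ≤
      (Fintype.card V : ℝ) ^ sampleSize ε := by
  set N := Fintype.card V with hN
  have hN0 : (0 : ℝ) < N := by exact_mod_cast Fintype.card_pos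
  have hdN : (d : ℝ) ≤ N := by
    obtain ⟨x⟩ := (inferInstance : Nonempty V)
    rw [← hdeg x]; exact_mod_cast card_le_univ _
  have hεd : ε * (N : ℝ) ^ 2 ≤ N * d := by
    refine (hε fun _ => true).trans ?_
    have h : (univ.filter fun p : V × V => A p.1 p.2 ∧ true = true).card = N * d := by
      simp only [and_true, card_filter, Fintype.sum_prod_type]
      simp only [← card_filter]
      rw [sum_congr rfl fun x _ => hdeg x]
      simp [hN]
    rw [h]; push_cast; rfl
  set μ : ℝ := d / N with hμ
  have hdμ : (d : ℝ) = μ * N := by rw [hμ]; field_simp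
  have hεμ : ε ≤ μ := by
    rw [hμ, le_div_iff₀ hN0]
    nlinarith
  have hμ0 : 0 < μ := hε0.trans_le hεμ
  have hμ1 : μ ≤ 1 := by rw [hμ, div_le_one hN0]; exact hdN
  have hd : 0 < d := by
    have : (0 : ℝ) < d := by rw [hdμ]; positivity
    exact_mod_cast this
  have hlog : 0 ≤ Real.log (24 / ε) := by
    apply Real.log_nonneg
    rw [le_div_iff₀ hε0]; linarith
  -- The split is chosen in the analysis only: the test does not know `μ`. Since `ε ≤ μ`, this `t`
  -- fits into the first summand of `sampleSize`, and all remaining points go to the second sample.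
  set t := ⌈Real.log (24 / ε) / μ⌉₊ with ht
  have ht1 : Real.log (24 / ε) ≤ μ * t := by
    rw [mul_comm, ← div_le_iff₀ hμ0]
    exact Nat.le_ceil _
  have ht2 : (t : ℝ) ≤ Real.log (24 / ε) / μ + 1 := (Nat.ceil_lt_add_one (by positivity)).le
  have htk : t ≤ ⌈logFactor ε / ε⌉₊ := by
    apply Nat.ceil_le_ceil
    rw [logFactor]
    gcongr
    linarith
  obtain ⟨j, hj⟩ : ∃ j, sampleSize ε = t + j :=
    Nat.exists_eq_add_of_le (htk.trans (Nat.le_add_right _ _))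
  have hj1 : 4 * logFactor ε / ε ≤ j := by
    refine (Nat.le_ceil _).trans ?_
    rw [sampleSize] at hj
    exact_mod_cast (by omega : ⌈4 * logFactor ε / ε⌉₊ ≤ j)
  rw [hj]
  have hmain := card_twoColourable_le A hA d hd hdeg (ε * (N : ℝ) ^ 2) (by positivity) hε t j
  rw [← hN] at hmain
  have e1 : 4 * d / (ε * (N : ℝ) ^ 2) * (N * ((N : ℝ) - d) ^ t) * (N : ℝ) ^ j =
      4 * μ / ε * (1 - μ) ^ t * (N : ℝ) ^ (t + j) := by
    have : (N : ℝ) - d = (1 - μ) * N := by rw [hdμ]; ring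
    rw [this, mul_pow, pow_add, hdμ]
    field_simp
  have e2 : (N : ℝ) ^ t * (2 ^ t * (((N : ℝ) - ε * (N : ℝ) ^ 2 / (4 * d)) ^ j *
      Real.exp ((N : ℝ) / d))) =
      2 ^ t * (1 - ε / (4 * μ)) ^ j * Real.exp (1 / μ) * (N : ℝ) ^ (t + j) := by
    have h1 : (N : ℝ) - ε * (N : ℝ) ^ 2 / (4 * d) = (1 - ε / (4 * μ)) * N := by
      rw [hdμ]; field_simp
    have h2 : (N : ℝ) / d = 1 / μ := by rw [hdμ]; field_simp
    rw [h1, h2, mul_pow, pow_add]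
    ring
  rw [e1, e2] at hmain
  have b1 : 4 * μ / ε * (1 - μ) ^ t ≤ 1 / 6 := by
    have h1 : (1 - μ) ^ t ≤ ε / 24 := by
      calc (1 - μ) ^ t ≤ Real.exp (-μ) ^ t :=
            pow_le_pow_left₀ (by linarith) (by linarith [Real.add_one_le_exp (-μ)]) t
        _ = Real.exp (-(μ * t)) := by rw [← Real.exp_nat_mul]; ring_nf
        _ ≤ Real.exp (-Real.log (24 / ε)) := Real.exp_le_exp.2 (by linarith)
        _ = ε / 24 := by rw [Real.exp_neg, Real.exp_log (by positivity), inv_div]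
    calc 4 * μ / ε * (1 - μ) ^ t ≤ 4 * μ / ε * (ε / 24) := by gcongr
      _ = μ / 6 := by field_simp; norm_num
      _ ≤ 1 / 6 := by linarith
  have b2 : 2 ^ t * (1 - ε / (4 * μ)) ^ j * Real.exp (1 / μ) ≤ 1 / 6 := by
    have hr0 : 0 ≤ 1 - ε / (4 * μ) := by
      rw [sub_nonneg, div_le_one (by positivity)]; linarith
    have h1 : (1 - ε / (4 * μ)) ^ j ≤ Real.exp (-(logFactor ε / μ)) := by
      calc (1 - ε / (4 * μ)) ^ j ≤ Real.exp (-(ε / (4 * μ))) ^ j :=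
            pow_le_pow_left₀ hr0 (by linarith [Real.add_one_le_exp (-(ε / (4 * μ)))]) j
        _ = Real.exp (-(ε / (4 * μ) * j)) := by rw [← Real.exp_nat_mul]; ring_nf
        _ ≤ Real.exp (-(ε / (4 * μ) * (4 * logFactor ε / ε))) := by gcongr
        _ = Real.exp (-(logFactor ε / μ)) := by congr 2; field_simp
    have h2 : (2 : ℝ) ^ t ≤ Real.exp t := by
      calc (2 : ℝ) ^ t ≤ Real.exp 1 ^ t :=
            pow_le_pow_left₀ (by norm_num) (by linarith [Real.add_one_le_exp (1 : ℝ)]) t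
        _ = Real.exp t := by rw [← Real.exp_nat_mul, mul_one]
    have h3 : 1 ≤ 1 / μ := by rw [le_div_iff₀ hμ0]; linarith
    calc 2 ^ t * (1 - ε / (4 * μ)) ^ j * Real.exp (1 / μ)
        ≤ Real.exp t * Real.exp (-(logFactor ε / μ)) * Real.exp (1 / μ) := by gcongr
      _ = Real.exp (t + -(logFactor ε / μ) + 1 / μ) := by rw [Real.exp_add, Real.exp_add]
      _ ≤ Real.exp (-5) := by
          apply Real.exp_le_exp.2
          -- The logarithms cancel and the exponent is at most `1 - 6 / μ ≤ -5`; this is what the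
          -- `7` in `logFactor` is for.
          have : logFactor ε / μ = Real.log (24 / ε) / μ + 7 * (1 / μ) := by
            rw [logFactor]; ring
          linarith
      _ ≤ 1 / 6 := by
          rw [Real.exp_neg, one_div]
          apply inv_anti₀ (by norm_num)
          linarith [Real.add_one_le_exp (5 : ℝ)]
  have hpos : (0 : ℝ) < (N : ℝ) ^ (t + j) := by positivity
  nlinarith [mul_le_mul_of_nonneg_right b1 hpos.le, mul_le_mul_of_nonneg_right b2 hpos.le]

/-! ### Characters of `𝔽₂ⁿ` -/

/-- The nontrivial real character of `𝔽₂`. -/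
def sgn (a : ZMod 2) : ℝ := if a = 0 then 1 else -1

theorem sgn_add (a b : ZMod 2) : sgn (a + b) = sgn a * sgn b := by
  have h : ∀ a : ZMod 2, a = 0 ∨ a = 1 := by decide
  have h1 : (1 : ZMod 2) + 1 = 0 := by decide
  rcases h a with rfl | rfl <;> rcases h b with rfl | rfl <;> simp [sgn, h1]

theorem sum_sgn_dotProduct {n : ℕ} (z : Cube n) :
    ∑ l : Cube n, sgn (l ⬝ᵥ z) = if z = 0 then (2 : ℝ) ^ n else 0 := by
  split_ifs with h
  · subst h; simp [sgn]
  · obtain ⟨i, hi⟩ : ∃ i, z i ≠ 0 := by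
      by_contra! h'
      exact h (funext h')
    have hi1 : z i = 1 := by
      have : ∀ a : ZMod 2, a ≠ 0 → a = 1 := by decide
      exact this _ hi
    -- Translation by a unit vector on which `z` is nonzero flips every sign, so the sum equals its
    -- negative.
    have hs := Equiv.sum_comp (Equiv.addRight (Pi.single i 1 : Cube n))
      fun l : Cube n => sgn (l ⬝ᵥ z)
    have hneg : ∀ l : Cube n, sgn (Equiv.addRight (Pi.single i 1 : Cube n) l ⬝ᵥ z) =
        -sgn (l ⬝ᵥ z) := by
      intro l
      have h1 : (Pi.single i 1 : Cube n) ⬝ᵥ z = 1 := by simp [hi1]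
      rw [Equiv.coe_addRight, add_dotProduct, sgn_add, h1]
      simp [sgn]
    simp only [hneg, sum_neg_distrib] at hs
    linarith

theorem cube_add_add_eq_zero_iff {n : ℕ} (z x y : Cube n) : z + x + y = 0 ↔ z = x - y := by
  have hx : x + x = 0 := by ext i; exact CharTwo.add_self_eq_zero _
  constructor
  · intro h
    have : z = (z + x + y) - (x + x) + (x - y) := by abel
    rw [this, h, hx]; simp
  · rintro rfl
    have : x - y + x + y = x + x := by abel
    rw [this, hx]

/-- The quadratic form of a convolution operator is diagonal in the basis of characters. -/
theorem sum_fourier_mul_sq {n : ℕ} (F s : Cube n → ℝ) :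
    ∑ l : Cube n, (∑ z, F z * sgn (l ⬝ᵥ z)) * (∑ x, s x * sgn (l ⬝ᵥ x)) ^ 2 =
      2 ^ n * ∑ x, ∑ y, F (x - y) * (s x * s y) := by
  calc ∑ l : Cube n, (∑ z, F z * sgn (l ⬝ᵥ z)) * (∑ x, s x * sgn (l ⬝ᵥ x)) ^ 2
      = ∑ l : Cube n, ∑ x, ∑ y, ∑ z, F z * (s x * s y) * sgn (l ⬝ᵥ (z + x + y)) := by
        refine sum_congr rfl fun l _ => ?_
        rw [sq, sum_mul_sum, mul_sum]
        refine sum_congr rfl fun x _ => ?_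
        rw [mul_sum]
        refine sum_congr rfl fun y _ => ?_
        rw [sum_mul]
        refine sum_congr rfl fun z _ => ?_
        rw [dotProduct_add, dotProduct_add, sgn_add, sgn_add]
        ring
    _ = ∑ x, ∑ y, ∑ z, F z * (s x * s y) * ∑ l : Cube n, sgn (l ⬝ᵥ (z + x + y)) := by
        rw [sum_comm]
        refine sum_congr rfl fun x _ => ?_
        rw [sum_comm]
        refine sum_congr rfl fun y _ => ?_
        rw [sum_comm]
        exact sum_congr rfl fun z _ => (mul_sum _ _ _).symm
    _ = _ := by
        rw [mul_sum]
        refine sum_congr rfl fun x _ => ?_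
        rw [mul_sum]
        refine sum_congr rfl fun y _ => ?_
        simp only [sum_sgn_dotProduct, cube_add_add_eq_zero_iff, mul_ite, mul_zero]
        rw [sum_ite_eq' univ (x - y)]
        simp only [mem_univ, if_true]
        ring

/-- Parseval, as the case of convolution with the indicator of `0`. -/
theorem sum_fourier_sq {n : ℕ} (s : Cube n → ℝ) :
    ∑ l : Cube n, (∑ x, s x * sgn (l ⬝ᵥ x)) ^ 2 = 2 ^ n * ∑ x, s x ^ 2 := by
  have h := sum_fourier_mul_sq (fun z : Cube n => if z = 0 then 1 else 0) s
  simp only [ite_mul, one_mul, zero_mul, sub_eq_zero] at h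
  simpa [sgn, sq] using h

/-- An odd number of vectors with `l ⬝ᵥ x = 1` has a sum with the same property, hence nonzero. -/
theorem oddCycleFree_and_dotProduct {n : ℕ} (f : BoolFun n) (l : Cube n) :
    OddCycleFree fun x => f x && decide (l ⬝ᵥ x = 1) := by
  rintro m hm ⟨x, hx, hf⟩
  simp only [Bool.and_eq_true, decide_eq_true_eq] at hf
  have h : l ⬝ᵥ ∑ i, x i = ∑ i, l ⬝ᵥ x i := dotProduct_sum _ _ _
  rw [hx, sum_congr rfl fun i _ => (hf i).2] at h
  simp only [dotProduct_zero, sum_const, card_univ, Fintype.card_fin, nsmul_eq_mul,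
    mul_one] at h
  rw [ZMod.natCast_eq_one_iff_odd.2 hm] at h
  exact zero_ne_one h

theorem le_card_of_isFar {n : ℕ} {f : BoolFun n} {ε : ℝ}
    (hf : IsFar {f : BoolFun n | OddCycleFree f} ε f) (l : Cube n) :
    ε * 2 ^ n ≤ (univ.filter fun x : Cube n => f x = true ∧ l ⬝ᵥ x = 0).card := by
  have h := hf (fun x => f x && decide (l ⬝ᵥ x = 1)) (oddCycleFree_and_dotProduct f l)
  rw [relDist, le_div_iff₀ (by positivity)] at h
  refine h.trans (le_of_eq ?_)
  rw [hammingDist]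
  congr 2
  ext x
  simp only [mem_filter, mem_univ, true_and]
  have h2 : ∀ a : ZMod 2, a = 0 ∨ a = 1 := by decide
  rcases h2 (l ⬝ᵥ x) with h | h <;> cases f x <;> simp [h]

/-- The right-hand side is the eigenvalue of the Cayley graph at the character `l`: ones of `f` with
`l ⬝ᵥ z = 0` minus those with `l ⬝ᵥ z = 1`. -/
theorem fourier_ge_of_isFar {n : ℕ} {f : BoolFun n} {ε : ℝ}
    (hf : IsFar {f : BoolFun n | OddCycleFree f} ε f) (l : Cube n) :
    2 * ε * 2 ^ n - (univ.filter fun x : Cube n => f x = true).card ≤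
      ∑ z, (if f z = true then 1 else 0) * sgn (l ⬝ᵥ z) := by
  have h := le_card_of_isFar hf l
  have h1 : ∑ z, (if f z = true then 1 else 0) * sgn (l ⬝ᵥ z) =
      2 * ((univ.filter fun x : Cube n => f x = true ∧ l ⬝ᵥ x = 0).card : ℝ) -
        (univ.filter fun x : Cube n => f x = true).card := by
    simp only [card_filter, Nat.cast_sum, mul_sum]
    rw [← sum_sub_distrib]
    refine sum_congr rfl fun z _ => ?_
    by_cases h1 : f z = true <;> by_cases h2 : l ⬝ᵥ z = 0 <;> simp [h1, h2, sgn]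
    norm_num
  rw [h1]
  linarith

/-- If `f` is far from odd-cycle-free, its Cayley graph is far from bipartite. -/
theorem le_card_monochromatic_of_isFar {n : ℕ} {f : BoolFun n} {ε : ℝ}
    (hf : IsFar {f : BoolFun n | OddCycleFree f} ε f) (χ : Cube n → Bool) :
    ε * (2 ^ n) ^ 2 ≤
      (univ.filter fun p : Cube n × Cube n => f (p.1 - p.2) = true ∧ χ p.1 = χ p.2).card := by
  set F : Cube n → ℝ := fun z => if f z = true then 1 else 0 with hF
  set s : Cube n → ℝ := fun x => if χ x = true then 1 else -1 with hs
  set D : ℝ := ((univ.filter fun x : Cube n => f x = true).card : ℝ) with hD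
  have hs2 : ∀ x, s x ^ 2 = 1 := by
    intro x; simp only [hs]; split_ifs <;> norm_num
  have hFD : ∑ z, F z = D := by simp [hF, hD]
  have hcard : (Fintype.card (Cube n) : ℝ) = 2 ^ n := by simp
  -- The least-eigenvalue bound for the sign vector of `χ`, whose squared Fourier coefficients sum
  -- to `(2 ^ n) ^ 2`.
  have h1 : (2 * ε * 2 ^ n - D) * (2 ^ n) ^ 2 ≤ 2 ^ n * ∑ x, ∑ y, F (x - y) * (s x * s y) := by
    rw [← sum_fourier_mul_sq]
    have h2 := sum_fourier_sq s
    simp only [hs2, sum_const, card_univ, nsmul_eq_mul, mul_one, hcard] at h2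
    rw [sq (2 ^ n : ℝ), ← h2, mul_sum]
    exact sum_le_sum fun l _ => mul_le_mul_of_nonneg_right (fourier_ge_of_isFar hf l) (sq_nonneg _)
  -- The indicator of `χ x = χ y` is `(1 + s x * s y) / 2`.
  have h3 : 2 * ((univ.filter fun p : Cube n × Cube n =>
      f (p.1 - p.2) = true ∧ χ p.1 = χ p.2).card : ℝ) =
      ∑ x, ∑ y, F (x - y) + ∑ x, ∑ y, F (x - y) * (s x * s y) := by
    simp only [card_filter, Nat.cast_sum, Fintype.sum_prod_type, mul_sum, ← sum_add_distrib]
    refine sum_congr rfl fun x _ => sum_congr rfl fun y _ => ?_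
    simp only [hF, hs]
    cases f (x - y) <;> cases χ x <;> cases χ y <;> norm_num
  have h4 : ∑ x, ∑ y, F (x - y) = 2 ^ n * D := by
    have : ∀ x, ∑ y, F (x - y) = D := fun x =>
      (Equiv.sum_comp (Equiv.subLeft x) F).trans hFD
    simp [this]
  have hp : (0 : ℝ) < 2 ^ n := by positivity
  have h5 : (2 * ε * 2 ^ n - D) * 2 ^ n ≤ ∑ x, ∑ y, F (x - y) * (s x * s y) := by
    refine le_of_mul_le_mul_left ?_ hp
    calc _ = (2 * ε * 2 ^ n - D) * (2 ^ n) ^ 2 := by ring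
      _ ≤ _ := h1
  nlinarith

/-! ### The test -/

/-- A family of vectors without odd dependencies lies on an affine hyperplane `φ = 1`. -/
theorem exists_dual_of_oddCycleFreeOn {n : ℕ} {G : Set (Cube n)} {f : BoolFun n}
    (h : OddCycleFreeOn G f) :
    ∃ φ : Cube n →ₗ[ZMod 2] ZMod 2, ∀ x ∈ G, f x = true → φ x ≠ 0 := by
  -- The extra coordinate records the parity of the number of summands: an odd cycle exists exactly
  -- when `(0, 1)` lies in the span.
  set S : Set (Cube n × ZMod 2) := (fun x => (x, 1)) '' {x | x ∈ G ∧ f x = true} with hS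
  have hlist : ∀ v ∈ Submodule.span (ZMod 2) S, ∃ L : List (Cube n),
      (∀ x ∈ L, x ∈ G ∧ f x = true) ∧ v = (L.sum, (L.length : ZMod 2)) := by
    intro v hv
    induction hv using Submodule.span_induction with
    | mem v hv =>
      obtain ⟨x, hx, rfl⟩ := hv
      exact ⟨[x], by simpa using hx, by simp⟩
    | zero => exact ⟨[], by simp, by simp [← Prod.zero_eq_mk]⟩
    | add u v _ _ hu hv =>
      obtain ⟨L, hL, rfl⟩ := hu
      obtain ⟨M, hM, rfl⟩ := hv
      refine ⟨L ++ M, fun x hx => ?_, by simp⟩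
      rcases List.mem_append.1 hx with hx | hx
      exacts [hL x hx, hM x hx]
    | smul a v _ hv =>
      have h2 : ∀ a : ZMod 2, a = 0 ∨ a = 1 := by decide
      rcases h2 a with rfl | rfl
      · exact ⟨[], by simp, by simp [← Prod.zero_eq_mk]⟩
      · simpa using hv
  have hnot : ((0, 1) : Cube n × ZMod 2) ∉ Submodule.span (ZMod 2) S := by
    intro hmem
    obtain ⟨L, hL, hv⟩ := hlist _ hmem
    rw [Prod.ext_iff] at hv
    refine h L.length (ZMod.natCast_eq_one_iff_odd.1 hv.2.symm)
      ⟨L.get, fun i => (hL _ (L.get_mem i)).1, ?_, fun i => (hL _ (L.get_mem i)).2⟩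
    rw [← List.sum_ofFn, List.ofFn_get]
    exact hv.1.symm
  obtain ⟨ψ, hψ, hker⟩ := Submodule.exists_le_ker_of_notMem hnot
  refine ⟨ψ.comp (LinearMap.inl _ _ _), fun x hx hfx h0 => hψ ?_⟩
  have h1 : ψ (x, 1) = 0 := hker (Submodule.subset_span ⟨x, ⟨hx, hfx⟩, rfl⟩)
  have h2 : ((0, 1) : Cube n × ZMod 2) = (x, 1) - (x, 0) := by simp
  rw [h2, map_sub, h1]
  simpa using h0

/-- Colour each sample point by the value of the separating functional; this is nonzero on every
difference that is an edge. -/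
theorem twoColourable_of_oddCycleFreeOn {n k : ℕ} {f : BoolFun n} {α : Fin k → Cube n}
    (h : OddCycleFreeOn (differences α : Set (Cube n)) f) :
    TwoColourable (fun x y => f (x - y) = true) α := by
  obtain ⟨φ, hφ⟩ := exists_dual_of_oddCycleFreeOn h
  refine ⟨fun i => decide (φ (α i) = 0), fun i j hij hf heq => ?_⟩
  have hne := hφ (α i - α j) (by
    simp only [differences, coe_image, Set.mem_image]
    exact ⟨(i, j), by simpa using hij, rfl⟩) hf
  rw [map_sub] at hne
  have h2 : ∀ a b : ZMod 2, a - b ≠ 0 → decide (a = 0) ≠ decide (b = 0) := by decide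
  exact h2 _ _ hne heq

/-! ### Runs, query counts and verdict probabilities of the test -/

namespace QueryAlg

variable {Q A B : Type}

theorem run_map (φ : A → B) (T : QueryAlg Q A) (f : Q → Bool) :
    (T.map φ).run f = φ (T.run f) := by
  induction T with
  | ret a => rfl
  | ask q next ih => exact ih _

theorem queries_map (φ : A → B) (T : QueryAlg Q A) (f : Q → Bool) :
    (T.map φ).queries f = T.queries f := by
  induction T with
  | ret a => rfl
  | ask q next ih => simp only [map, queries, ih]

theorem queries_queryAll [DecidableEq Q] (l : List Q) (t f : Q → Bool) :
    (queryAll l t).queries f = l.length := by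
  induction l generalizing t with
  | nil => rfl
  | cons q l ih => simp [queryAll, queries, ih]

theorem run_queryAll [DecidableEq Q] (l : List Q) (t f : Q → Bool) (x : Q) :
    (queryAll l t).run f x = if x ∈ l then f x else t x := by
  induction l generalizing t with
  | nil => simp [queryAll, run]
  | cons q l ih =>
    simp only [queryAll, run, ih, List.mem_cons, Function.update_apply]
    by_cases h1 : x ∈ l <;> by_cases h2 : x = q <;> simp [h1, h2]

end QueryAlg

theorem OddCycleFreeOn.congr {n : ℕ} {G : Set (Cube n)} {f g : BoolFun n}
    (h : ∀ x ∈ G, f x = g x) : OddCycleFreeOn G f ↔ OddCycleFreeOn G g := by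
  refine forall₂_congr fun m _ => not_congr (exists_congr fun x => ?_)
  refine and_congr_right fun hx => and_congr_right fun _ => forall_congr' fun i => ?_
  rw [h _ (hx i)]

open Classical in
theorem run_edgeSamplingFor {n k : ℕ} (α : Fin k → Cube n) (f : BoolFun n) :
    (edgeSamplingFor α).run f = decide (OddCycleFreeOn (differences α : Set (Cube n)) f) := by
  rw [edgeSamplingFor, QueryAlg.run_map, decide_eq_decide]
  refine OddCycleFreeOn.congr fun x hx => ?_
  rw [QueryAlg.run_queryAll, if_pos (by simpa using hx)]

theorem queries_edgeSamplingFor_le {n k : ℕ} (α : Fin k → Cube n) (f : BoolFun n) :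
    (edgeSamplingFor α).queries f ≤ k ^ 2 := by
  rw [edgeSamplingFor, QueryAlg.queries_map, QueryAlg.queries_queryAll, length_toList, differences]
  refine card_image_le.trans ((card_le_univ _).trans_eq ?_)
  simp [sq]

open Classical in
theorem probVerdict_edgeSamplingTest {n k : ℕ} (f : BoolFun n) (b : Bool) :
    probVerdict (edgeSamplingTest k n) f b =
      ((univ.filter fun α : Fin k → Cube n => (edgeSamplingFor α).run f = b).card : ENNReal) /
        Fintype.card (Fin k → Cube n) := by
  rw [probVerdict, edgeSamplingTest, PMF.map_comp, PMF.map_apply, tsum_fintype, card_filter,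
    Nat.cast_sum, div_eq_mul_inv, sum_mul]
  refine sum_congr rfl fun α _ => ?_
  simp only [Function.comp_apply, PMF.uniformOfFintype_apply, eq_comm (a := b)]
  split_ifs <;> simp

theorem probVerdict_true_of_oddCycleFree {n : ℕ} (k : ℕ) {f : BoolFun n} (hf : OddCycleFree f) :
    probVerdict (edgeSamplingTest k n) f true = 1 := by
  classical
  rw [probVerdict_edgeSamplingTest]
  have h : ∀ α : Fin k → Cube n, (edgeSamplingFor α).run f = true := by
    intro α
    rw [run_edgeSamplingFor, decide_eq_true_eq]
    rintro m hm ⟨x, _, hx, hfx⟩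
    exact hf m hm ⟨x, hx, hfx⟩
  simp only [h, filter_true, card_univ]
  exact ENNReal.div_self (by simp) (ENNReal.natCast_ne_top _)

theorem probVerdict_false_of_isFar {n : ℕ} {ε : ℝ} (hε0 : 0 < ε) (hε1 : ε < 1) {f : BoolFun n}
    (hf : IsFar {f : BoolFun n | OddCycleFree f} ε f) :
    2 / 3 ≤ probVerdict (edgeSamplingTest (sampleSize ε) n) f false := by
  classical
  have hsymm : ∀ x y : Cube n, x - y = y - x := fun x y => by
    ext i; simp only [Pi.sub_apply, CharTwo.sub_eq_add, add_comm]
  have hcard : (Fintype.card (Cube n) : ℝ) = 2 ^ n := by simp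
  have h3 := three_mul_card_twoColourable_le (fun x y : Cube n => f (x - y) = true)
    (fun x y h => by rw [hsymm]; exact h) (univ.filter fun x : Cube n => f x = true).card
    (fun x => card_bij (fun y _ => x - y) (by simp)
      (fun y _ y' _ h => by simpa using h)
      (fun z hz => ⟨x - z, by simpa using hz, by simp⟩)) ε hε0 hε1
    (fun χ => by rw [hcard]; convert le_card_monochromatic_of_isFar hf χ)
  set k := sampleSize ε
  rw [probVerdict_edgeSamplingTest]
  set M := Fintype.card (Fin k → Cube n) with hM
  set R := (univ.filter fun α : Fin k → Cube n => (edgeSamplingFor α).run f = false).card with hR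
  set C := (univ.filter fun α : Fin k → Cube n =>
    TwoColourable (fun x y : Cube n => f (x - y) = true) α).card with hC
  have hMN : (M : ℝ) = (Fintype.card (Cube n) : ℝ) ^ k := by
    rw [hM, Fintype.card_pi]; simp
  have h3' : 3 * C ≤ M := by
    rw [← hMN] at h3
    exact_mod_cast h3
  -- Every sample is rejected or 2-colourable, and at most a third are 2-colourable.
  have hRC : M ≤ R + C := by
    rw [hM, ← card_univ, hR, hC]
    refine (card_le_card fun α _ => ?_).trans (card_union_le _ _)
    simp only [mem_union, mem_filter, mem_univ, true_and, run_edgeSamplingFor, decide_eq_false_iff_not]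
    by_cases h : OddCycleFreeOn (differences α : Set (Cube n)) f
    · exact Or.inr (twoColourable_of_oddCycleFreeOn h)
    · exact Or.inl h
  have h2 : 2 * M ≤ R * 3 := by omega
  have hM0 : (M : ENNReal) ≠ 0 := by simp [hM]
  rw [ENNReal.le_div_iff_mul_le (Or.inl hM0) (Or.inl (ENNReal.natCast_ne_top _)),
    ENNReal.mul_comm_div, mul_comm, ENNReal.mul_comm_div, ← mul_div_assoc, ENNReal.div_le_iff_le_mul
      (Or.inl (by norm_num)) (Or.inl (by norm_num))]
  exact_mod_cast (by linarith : M * 2 ≤ R * 3)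

theorem sampleSize_le {ε : ℝ} (hε0 : 0 < ε) (hε1 : ε < 1) :
    (sampleSize ε : ℝ) ≤ 210 * (1 / ε) * (1 + Real.log (1 / ε)) := by
  have hlog : 0 ≤ Real.log (1 / ε) := Real.log_nonneg (by rw [le_div_iff₀ hε0]; linarith)
  have h24 : Real.log 24 ≤ 23 := by linarith [Real.log_le_sub_one_of_pos (x := 24) (by norm_num)]
  have h24' : 0 ≤ Real.log 24 := Real.log_nonneg (by norm_num)
  have hL : logFactor ε = Real.log 24 + Real.log (1 / ε) + 7 := by
    rw [logFactor, ← Real.log_mul (by norm_num) (by positivity), mul_one_div]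
  have hL1 : logFactor ε ≤ 30 * (1 + Real.log (1 / ε)) := by rw [hL]; linarith
  have hL0 : 1 ≤ logFactor ε := by rw [hL]; linarith
  -- Absorbs the two roundings up: `5 + 2 = 7` multiples of `logFactor ε / ε`, whence `210 = 7 *
  -- 30`.
  have h1 : 1 ≤ logFactor ε / ε := by rw [le_div_iff₀ hε0]; linarith
  have c1 := (Nat.ceil_lt_add_one (a := logFactor ε / ε) (by positivity)).le
  have c2 := (Nat.ceil_lt_add_one (a := 4 * logFactor ε / ε) (by positivity)).le
  have h4 : 4 * logFactor ε / ε = 4 * (logFactor ε / ε) := by ring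
  have h5 : logFactor ε / ε ≤ 30 * (1 + Real.log (1 / ε)) / ε := by gcongr
  have h6 : 210 * (1 / ε) * (1 + Real.log (1 / ε)) =
      7 * (30 * (1 + Real.log (1 / ε)) / ε) := by ring
  rw [sampleSize, h6]
  push_cast
  linarith

end PropertyTesting

theorem theorem1 :
    ∃ k q : ℝ → ℕ,
      PropertyTesting.IsSoftO k (fun ε => 1 / ε) ∧
      PropertyTesting.IsSoftO q (fun ε => 1 / ε ^ 2) ∧
      PropertyTesting.IsOneSidedTester
        (fun n => {f : PropertyTesting.BoolFun n | PropertyTesting.OddCycleFree f})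
        (fun ε n => PropertyTesting.edgeSamplingTest (k ε) n) ∧
      ∀ ε : ℝ, 0 < ε → ε < 1 → ∀ n : ℕ,
        PropertyTesting.QueryComplexityLE (PropertyTesting.edgeSamplingTest (k ε) n) (q ε) := by
  refine ⟨PropertyTesting.sampleSize, fun ε => PropertyTesting.sampleSize ε ^ 2,
    ⟨210, 1, fun ε h0 h1 => ?_⟩, ⟨210 ^ 2, 2, fun ε h0 h1 => ?_⟩,
    fun ε h0 h1 n f => ⟨fun hf => PropertyTesting.probVerdict_true_of_oddCycleFree _ hf,
      fun hf => PropertyTesting.probVerdict_false_of_isFar h0 h1 hf⟩, fun ε _ _ n D hD f => ?_⟩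
  · simpa using PropertyTesting.sampleSize_le h0 h1
  · have h := pow_le_pow_left₀ (Nat.cast_nonneg _) (PropertyTesting.sampleSize_le h0 h1) 2
    push_cast
    refine h.trans (le_of_eq ?_)
    ring
  · obtain ⟨α, _, rfl⟩ := (PMF.mem_support_map_iff _ _ _).1 hD
    exact PropertyTesting.queries_edgeSamplingFor_le α f
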